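/- Let $\Sigma$ be a smooth three-manifold, let $\mathfrak{e}=(e_u,e_l,e_n)$ be a global smooth coframe on $\Sigma$ (three smooth one-forms that are linearly independent at every point), and let $\Theta$ be a smooth symmetric covariant two-tensor on $\Sigma$. Let $$h = e_u\otimes e_u + e_l\otimes e_l + e_n\otimes e_n$$ be the Riemannian metric for which $\mathfrak{e}$ is orthonormal, and let $\nabla^h$ be its Levi-Civita connection. For a one-form $\alpha$ put $\Theta(\alpha) := \Theta(\alpha^{\sharp_h},\cdot)$; write $(\nabla^h\alpha)(X,Y)=(\nabla^h_X\alpha)(Y)$, $(\alpha\otimes\beta)(X,Y)=\alpha(X)\beta(Y)$ and $\alpha\wedge\beta=\alpha\otimes\beta-\beta\otimes\alpha$. Then the constraint equations $$\nabla^h e_u + \Theta = \Theta(e_u)\otimes e_u ,\qquad \nabla^h e_l = \Theta(e_l)\otimes e_u ,\qquad [\Theta(e_u)] = 0 \in H^1(\Sigma,\mathbb{R})$$ hold if and only if the exterior differential system $$\mathrm{d} e_u = \Theta(e_u)\wedge e_u ,\qquad \mathrm{d} e_l = \Theta(e_l)\wedge e_u ,\qquad \mathrm{d} e_n = \Theta(e_n)\wedge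 e_u ,\qquad [\Theta(e_u)] = 0 \in H^1(\Sigma,\mathbb{R})$$ holds. Here $[\Theta(e_u)]=0$ means that $\Theta(e_u)$ is closed and its de Rham class vanishes. -/

import Mathlib

open scoped Manifold ContDiff

set_option linter.unusedSectionVars false

noncomputable section

namespace CauchyGeometry

section General

variable {E : Type*} [NormedAddCommGroup E] [NormedSpace ℝ E] {H : Type*} [TopologicalSpace H]
  (I : ModelWithCorners ℝ E H) (M : Type*) [TopologicalSpace M] [ChartedSpace H M]
  [IsManifold I ∞ M]

/-- Smooth one-forms: smooth sections of the cotangent bundle. -/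
abbrev OneForm := Cₛ^∞⟮I; E →L[ℝ] ℝ, fun x : M ↦ TangentSpace I x →L[ℝ] ℝ⟯

/-- Smooth covariant two-tensors: smooth sections of the bundle of bilinear forms on the tangent
bundle. -/
abbrev TwoTensor := Cₛ^∞⟮I; E →L[ℝ] E →L[ℝ] ℝ,
  fun x : M ↦ TangentSpace I x →L[ℝ] TangentSpace I x →L[ℝ] ℝ⟯

/-- Smooth Riemannian metrics on the manifold. -/
abbrev Metric := Bundle.ContMDiffRiemannianMetric I ∞ E (fun x : M ↦ TangentSpace I x)

variable {I M}

/-- The tensor product of covectors, `(α ⊗ β) (v, w) = α v * β w`. -/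
def tensor {x : M} (α β : TangentSpace I x →L[ℝ] ℝ) :
    TangentSpace I x →L[ℝ] TangentSpace I x →L[ℝ] ℝ :=
  α.smulRight β

/-- The wedge product of covectors, `α ∧ β = α ⊗ β - β ⊗ α`. -/
def wedge {x : M} (α β : TangentSpace I x →L[ℝ] ℝ) :
    TangentSpace I x →L[ℝ] TangentSpace I x →L[ℝ] ℝ :=
  tensor α β - tensor β α

/-! ### Auxiliary facts on smooth sections -/

theorem trivializationAt_oneForm (x₀ x : M) (A : TangentSpace I x →L[ℝ] ℝ) (v : E) :
    (trivializationAt (E →L[ℝ] ℝ) (fun x : M ↦ TangentSpace I x →L[ℝ] ℝ) x₀ ⟨x, A⟩).2 v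
      = A ((trivializationAt E (TangentSpace I) x₀).symmL ℝ x v) := by
  simp [hom_trivializationAt_apply, ContinuousLinearMap.inCoordinates]

theorem trivializationAt_twoTensor (x₀ x : M)
    (hx : x ∈ (trivializationAt E (TangentSpace I) x₀).baseSet)
    (A : TangentSpace I x →L[ℝ] TangentSpace I x →L[ℝ] ℝ) (v w : E) :
    (trivializationAt (E →L[ℝ] E →L[ℝ] ℝ)
      (fun x : M ↦ TangentSpace I x →L[ℝ] TangentSpace I x →L[ℝ] ℝ) x₀ ⟨x, A⟩).2 v w
      = A ((trivializationAt E (TangentSpace I) x₀).symmL ℝ x v)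
          ((trivializationAt E (TangentSpace I) x₀).symmL ℝ x w) := by
  rw [hom_trivializationAt_apply]
  simp only [ContinuousLinearMap.inCoordinates, ContinuousLinearMap.comp_apply]
  rw [Bundle.Trivialization.continuousLinearMapAt_apply, Bundle.Trivialization.linearMapAt_apply,
    if_pos ⟨hx, trivial⟩]
  exact trivializationAt_oneForm ..

theorem baseSet_mem_nhds (x₀ : M) :
    (trivializationAt E (TangentSpace I) x₀).baseSet ∈ nhds x₀ :=
  (trivializationAt E (TangentSpace I) x₀).open_baseSet.mem_nhds
    (FiberBundle.mem_baseSet_trivializationAt' x₀)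

theorem contMDiff_tensor (α β : OneForm I M) :
    ContMDiff I (I.prod 𝓘(ℝ, E →L[ℝ] E →L[ℝ] ℝ)) ∞
      (fun x ↦ Bundle.TotalSpace.mk' (E →L[ℝ] E →L[ℝ] ℝ)
        (E := fun x : M ↦ TangentSpace I x →L[ℝ] TangentSpace I x →L[ℝ] ℝ) x
        (tensor (α x) (β x))) := by
  intro x₀
  have hα := α.contMDiff x₀
  have hβ := β.contMDiff x₀
  rw [Bundle.contMDiffAt_section] at hα hβ ⊢
  have key : ContDiff ℝ ∞ (fun p : (E →L[ℝ] ℝ) × (E →L[ℝ] ℝ) ↦ p.1.smulRight p.2) := by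
    fun_prop
  refine (key.contMDiff.contMDiffAt.comp x₀ (hα.prodMk_space hβ)).congr_of_eventuallyEq ?_
  filter_upwards [baseSet_mem_nhds (I := I) x₀] with x hx
  ext v w
  rw [trivializationAt_twoTensor _ _ hx]
  simp [trivializationAt_oneForm, tensor]

theorem mdifferentiableAt_oneForm_apply (α : OneForm I M) {x : M}
    {Y : ∀ x : M, TangentSpace I x} (hY : MDiffAt (T% Y) x) :
    MDiffAt (fun y ↦ α y (Y y)) x := by
  have : MDifferentiableAt I (I.prod 𝓘(ℝ, ℝ))
      (fun y ↦ Bundle.TotalSpace.mk' ℝ (E := Bundle.Trivial M ℝ) y (α y (Y y))) x :=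
    MDifferentiableAt.clm_bundle_apply (F₁ := E) (F₂ := ℝ) (E₂ := Bundle.Trivial M ℝ)
      α.mdifferentiableAt hY
  simp only [mdifferentiableAt_totalSpace] at this
  exact this.2

theorem mdifferentiableAt_metric_apply (h : Metric I M) {x : M}
    {Y Z : ∀ x : M, TangentSpace I x} (hY : MDiffAt (T% Y) x) (hZ : MDiffAt (T% Z) x) :
    MDiffAt (fun y ↦ h.inner y (Y y) (Z y)) x := by
  have : MDifferentiableAt I (I.prod 𝓘(ℝ, ℝ))
      (fun y ↦ Bundle.TotalSpace.mk' ℝ (E := Bundle.Trivial M ℝ) y (h.inner y (Y y) (Z y))) x :=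
    MDifferentiableAt.clm_bundle_apply₂ (F₁ := E) (F₂ := E) (F₃ := ℝ) (E₃ := Bundle.Trivial M ℝ)
      (h.contMDiff.mdifferentiable (by simp) x) hY hZ
  simp only [mdifferentiableAt_totalSpace] at this
  exact this.2

theorem metric_injective (h : Metric I M) (x : M) : Function.Injective (h.inner x) := by
  rw [injective_iff_map_eq_zero]
  intro v hv
  by_contra hne
  have := h.pos x v hne
  simp [hv] at this

theorem covDeriv_tensorial_left (cov : CovariantDerivative I E (TangentSpace I : M → Type _))
    (α : OneForm I M) (x : M) (Y : ∀ x : M, TangentSpace I x) :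
    TensorialAt I E (fun X : ∀ x : M, TangentSpace I x ↦
      d% (fun y ↦ α y (Y y)) x (X x) - α x (cov Y x (X x))) x where
  smul {f X} hf hX := by
    simp
    ring
  add {X X'} hX hX' := by
    simp
    ring

theorem covDeriv_tensorial_right (cov : CovariantDerivative I E (TangentSpace I : M → Type _))
    (α : OneForm I M) (x : M) (X : ∀ x : M, TangentSpace I x) :
    TensorialAt I E (fun Y : ∀ x : M, TangentSpace I x ↦
      d% (fun y ↦ α y (Y y)) x (X x) - α x (cov Y x (X x))) x where
  smul {f Y} hf hY := by
    have : (fun y ↦ α y ((f • Y) y)) = fun y ↦ f y * α y (Y y) := by ext; simp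
    rw [this, mvfderiv_fun_mul hf (mdifferentiableAt_oneForm_apply α hY),
      cov.isCovariantDerivativeOn.leibniz hY hf]
    simp
    ring
  add {Y Y'} hY hY' := by
    have : (fun y ↦ α y ((Y + Y') y)) = fun y ↦ α y (Y y) + α y (Y' y) := by ext; simp
    rw [this, mvfderiv_fun_add (mdifferentiableAt_oneForm_apply α hY)
      (mdifferentiableAt_oneForm_apply α hY'), cov.isCovariantDerivativeOn.add hY hY']
    simp
    ring

variable (I M) in
/-- The space of exact one-forms: the differentials of smooth functions. -/
def exactOneForms : Submodule ℝ (OneForm I M) where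
  carrier := {α | ∃ f : M → ℝ, ContMDiff I 𝓘(ℝ, ℝ) ∞ f ∧ ∀ x, α x = d% f x}
  add_mem' := by
    rintro α β ⟨f, hf, hα⟩ ⟨g, hg, hβ⟩
    refine ⟨fun x ↦ f x + g x, hf.add hg, fun x ↦ ?_⟩
    rw [mvfderiv_fun_add (hf.mdifferentiable (by simp) x) (hg.mdifferentiable (by simp) x),
      ← hα, ← hβ]
    rfl
  zero_mem' := ⟨fun _ ↦ 0, contMDiff_const, fun x ↦ by rw [mvfderiv_const]; rfl⟩
  smul_mem' := by
    rintro c α ⟨f, hf, hα⟩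
    refine ⟨fun x ↦ c * f x, contMDiff_const.mul hf, fun x ↦ ?_⟩
    rw [mvfderiv_fun_mul mdifferentiableAt_const (hf.mdifferentiable (by simp) x), ← hα,
      mvfderiv_const]
    ext v
    simp

variable [FiniteDimensional ℝ E]

/-! ### Exterior derivative of one-forms and the first de Rham cohomology -/

/-- The expression `X(α(Y)) - Y(α(X)) - α([X, Y])` at the point `x`. -/
def extDerivAux (α : OneForm I M) (x : M) (X Y : ∀ x : M, TangentSpace I x) : ℝ :=
  d% (fun y ↦ α y (Y y)) x (X x) - d% (fun y ↦ α y (X y)) x (Y x)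
    - α x (VectorField.mlieBracket I X Y x)

theorem extDerivAux_tensorial_left (α : OneForm I M) (x : M) (Y : ∀ x : M, TangentSpace I x) :
    TensorialAt I E (extDerivAux α x · Y) x where
  smul {f X} hf hX := by
    have : (fun y ↦ α y ((f • X) y)) = fun y ↦ f y * α y (X y) := by ext; simp
    simp only [extDerivAux]
    rw [this, mvfderiv_fun_mul hf (mdifferentiableAt_oneForm_apply α hX),
      VectorField.mlieBracket_smul_left hf hX]
    simp
    ring
  add {X X'} hX hX' := by
    have : (fun y ↦ α y ((X + X') y)) = fun y ↦ α y (X y) + α y (X' y) := by ext; simp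
    simp only [extDerivAux]
    rw [this, mvfderiv_fun_add (mdifferentiableAt_oneForm_apply α hX)
      (mdifferentiableAt_oneForm_apply α hX'), VectorField.mlieBracket_add_left hX hX']
    simp
    ring

theorem extDerivAux_tensorial_right (α : OneForm I M) (x : M) (X : ∀ x : M, TangentSpace I x) :
    TensorialAt I E (extDerivAux α x X ·) x where
  smul {f Y} hf hY := by
    have : (fun y ↦ α y ((f • Y) y)) = fun y ↦ f y * α y (Y y) := by ext; simp
    simp only [extDerivAux]
    rw [this, mvfderiv_fun_mul hf (mdifferentiableAt_oneForm_apply α hY),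
      VectorField.mlieBracket_smul_right hf hY]
    simp
    ring
  add {Y Y'} hY hY' := by
    have : (fun y ↦ α y ((Y + Y') y)) = fun y ↦ α y (Y y) + α y (Y' y) := by ext; simp
    simp only [extDerivAux]
    rw [this, mvfderiv_fun_add (mdifferentiableAt_oneForm_apply α hY)
      (mdifferentiableAt_oneForm_apply α hY'), VectorField.mlieBracket_add_right hY hY']
    simp
    ring

/-- The exterior derivative of a one-form: the tensor `dα` with
`dα(X, Y) = X(α(Y)) - Y(α(X)) - α([X, Y])`. -/
def extDeriv (α : OneForm I M) (x : M) : TangentSpace I x →L[ℝ] TangentSpace I x →L[ℝ] ℝ :=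
  TensorialAt.mkHom₂ (extDerivAux α x) x (fun Y _ ↦ extDerivAux_tensorial_left α x Y)
    (fun X _ ↦ extDerivAux_tensorial_right α x X)

theorem extDeriv_apply (α : OneForm I M) {x : M} {X Y : ∀ x : M, TangentSpace I x}
    (hX : MDiffAt (T% X) x) (hY : MDiffAt (T% Y) x) :
    extDeriv α x (X x) (Y x) = d% (fun y ↦ α y (Y y)) x (X x) - d% (fun y ↦ α y (X y)) x (Y x)
      - α x (VectorField.mlieBracket I X Y x) :=
  TensorialAt.mkHom₂_apply _ _ hX hY

theorem extDeriv_add (α β : OneForm I M) (x : M) :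
    extDeriv (α + β) x = extDeriv α x + extDeriv β x := by
  ext v w
  have e (Y : ∀ x : M, TangentSpace I x) :
      (fun y ↦ (α + β) y (Y y)) = fun y ↦ α y (Y y) + β y (Y y) := by ext; simp
  have hd (v : TangentSpace I x) : MDiffAt (T% (FiberBundle.extend E v)) x :=
    FiberBundle.mdifferentiableAt_extend I E v
  simp only [add_apply, extDeriv, TensorialAt.mkHom₂_apply_eq_extend,
    extDerivAux]
  rw [e, e, mvfderiv_fun_add (mdifferentiableAt_oneForm_apply α (hd v))
    (mdifferentiableAt_oneForm_apply β (hd v)),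
    mvfderiv_fun_add (mdifferentiableAt_oneForm_apply α (hd w))
    (mdifferentiableAt_oneForm_apply β (hd w))]
  simp
  ring

theorem extDeriv_smul (c : ℝ) (α : OneForm I M) (x : M) :
    extDeriv (c • α) x = c • extDeriv α x := by
  ext v w
  have e (Y : ∀ x : M, TangentSpace I x) :
      (fun y ↦ (c • α) y (Y y)) = fun y ↦ c * α y (Y y) := by ext; simp
  have hd (v : TangentSpace I x) : MDiffAt (T% (FiberBundle.extend E v)) x :=
    FiberBundle.mdifferentiableAt_extend I E v
  simp only [smul_apply, extDeriv, TensorialAt.mkHom₂_apply_eq_extend,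
    extDerivAux]
  rw [e, e, mvfderiv_fun_mul mdifferentiableAt_const (mdifferentiableAt_oneForm_apply α (hd v)),
    mvfderiv_fun_mul mdifferentiableAt_const (mdifferentiableAt_oneForm_apply α (hd w))]
  simp [mvfderiv_const]
  ring

variable (I M) in
/-- The space of closed one-forms. -/
def closedOneForms : Submodule ℝ (OneForm I M) where
  carrier := {α | ∀ x, extDeriv α x = 0}
  add_mem' {α β} hα hβ x := by
    ext v w
    simp [extDeriv_add, hα x, hβ x]
  zero_mem' x := by
    have := extDeriv_smul 0 (0 : OneForm I M) x
    have e : (0 : ℝ) • (0 : OneForm I M) = 0 := by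
      ext y v
      simp
    rw [e] at this
    refine this.trans ?_
    ext v w
    simp
  smul_mem' c α hα x := by
    ext v w
    simp [extDeriv_smul, hα x]

variable (I M) in
/-- The first de Rham cohomology `H¹(M, ℝ)`: closed one-forms modulo exact one-forms. -/
abbrev DeRhamH1 := closedOneForms I M ⧸ (exactOneForms I M).submoduleOf (closedOneForms I M)

/-- The condition `[α] = 0 ∈ H¹(M, ℝ)`: the one-form `α` is closed and its class vanishes. -/
def HasZeroClass (α : OneForm I M) : Prop :=
  ∃ hα : α ∈ closedOneForms I M, (Submodule.Quotient.mk ⟨α, hα⟩ : DeRhamH1 I M) = 0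

/-! ### Musical isomorphisms -/

/-- The musical isomorphism `v ↦ h(v, ·)` from tangent vectors to covectors. -/
def flat (h : Metric I M) (x : M) : TangentSpace I x ≃ₗ[ℝ] (TangentSpace I x →L[ℝ] ℝ) :=
  haveI : FiniteDimensional ℝ (TangentSpace I x) := inferInstanceAs (FiniteDimensional ℝ E)
  haveI : T2Space (TangentSpace I x) := inferInstanceAs (T2Space E)
  LinearMap.linearEquivOfInjective
    (h.inner x : TangentSpace I x →ₗ[ℝ] (TangentSpace I x →L[ℝ] ℝ))
    (metric_injective h x) (by
      rw [← (LinearMap.toContinuousLinearMap (𝕜 := ℝ) (E := TangentSpace I x)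
        (F' := ℝ)).finrank_eq]
      exact Subspace.dual_finrank_eq.symm)

theorem flat_apply (h : Metric I M) (x : M) (v : TangentSpace I x) :
    flat h x v = h.inner x v := rfl

/-- The metric dual `α ↦ α♯` of covectors. -/
def sharp (h : Metric I M) (x : M) (α : TangentSpace I x →L[ℝ] ℝ) : TangentSpace I x :=
  (flat h x).symm α

theorem metric_sharp (h : Metric I M) (x : M) (α : TangentSpace I x →L[ℝ] ℝ)
    (v : TangentSpace I x) : h.inner x (sharp h x α) v = α v := by
  rw [← flat_apply, sharp, LinearEquiv.apply_symm_apply]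

theorem contMDiff_apply_sharp (h : Metric I M) (T : TwoTensor I M) (α : OneForm I M) :
    ContMDiff I (I.prod 𝓘(ℝ, E →L[ℝ] ℝ)) ∞
      (fun x ↦ Bundle.TotalSpace.mk' (E →L[ℝ] ℝ)
        (E := fun x : M ↦ TangentSpace I x →L[ℝ] ℝ) x (T x (sharp h x (α x)))) := by
  have : CompleteSpace E := FiniteDimensional.complete ℝ E
  intro x₀
  have hα := α.contMDiff x₀
  have hT := T.contMDiff x₀
  have hh := h.contMDiff x₀
  rw [Bundle.contMDiffAt_section] at hα hT hh ⊢
  set G : M → (E →L[ℝ] E →L[ℝ] ℝ) := fun x ↦ (trivializationAt (E →L[ℝ] E →L[ℝ] ℝ)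
    (fun x : M ↦ TangentSpace I x →L[ℝ] TangentSpace I x →L[ℝ] ℝ) x₀ ⟨x, h.inner x⟩).2 with hG
  have hGinj : ∀ x ∈ (trivializationAt E (TangentSpace I) x₀).baseSet,
      ∀ v, G x v = 0 → v = 0 := by
    intro x hx v hv
    have h1 : h.inner x ((trivializationAt E (TangentSpace I) x₀).symmL ℝ x v)
        ((trivializationAt E (TangentSpace I) x₀).symmL ℝ x v) = 0 := by
      rw [← trivializationAt_twoTensor x₀ x hx]
      change G x v v = 0
      simp [hv]
    have h2 : (trivializationAt E (TangentSpace I) x₀).symmL ℝ x v = 0 := by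
      by_contra hne
      exact (h.pos x _ hne).ne' h1
    have h3 := (trivializationAt E (TangentSpace I) x₀).continuousLinearMapAt_symmL
      (R := ℝ) hx v
    rw [h2] at h3
    simpa using h3.symm
  have hGinv : ∀ x ∈ (trivializationAt E (TangentSpace I) x₀).baseSet,
      ∃ e : E ≃L[ℝ] (E →L[ℝ] ℝ), (e : E →L[ℝ] (E →L[ℝ] ℝ)) = G x := by
    intro x hx
    let e := LinearMap.linearEquivOfInjective (G x : E →ₗ[ℝ] (E →L[ℝ] ℝ))
      ((injective_iff_map_eq_zero (G x)).2 (hGinj x hx)) (by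
      rw [← (LinearMap.toContinuousLinearMap (𝕜 := ℝ) (E := E) (F' := ℝ)).finrank_eq]
      exact Subspace.dual_finrank_eq.symm)
    exact ⟨e.toContinuousLinearEquiv, by ext v w; rfl⟩
  have hx₀ := FiberBundle.mem_baseSet_trivializationAt' (F := E)
    (E := (TangentSpace I : M → Type _)) x₀
  obtain ⟨e₀, he₀⟩ := hGinv x₀ hx₀
  have hinv : ContMDiffAt I 𝓘(ℝ, (E →L[ℝ] ℝ) →L[ℝ] E) ∞ (fun x ↦ (G x).inverse) x₀ := by
    have := contDiffAt_map_inverse (n := ∞) e₀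
    rw [he₀] at this
    exact this.contMDiffAt.comp x₀ hh
  refine (hT.clm_apply (hinv.clm_apply hα)).congr_of_eventuallyEq ?_
  filter_upwards [baseSet_mem_nhds (I := I) x₀] with x hx
  obtain ⟨e, he⟩ := hGinv x hx
  have hs : (G x).inverse ((trivializationAt (E →L[ℝ] ℝ)
        (fun x : M ↦ TangentSpace I x →L[ℝ] ℝ) x₀ ⟨x, α x⟩).2)
      = (trivializationAt E (TangentSpace I) x₀).continuousLinearMapAt ℝ x
        (sharp h x (α x)) := by
    rw [← he, ContinuousLinearMap.inverse_equiv]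
    change e.symm _ = _
    rw [ContinuousLinearEquiv.symm_apply_eq]
    ext w
    have : (e : E →L[ℝ] (E →L[ℝ] ℝ)) ((trivializationAt E (TangentSpace I)
        x₀).continuousLinearMapAt ℝ x (sharp h x (α x))) w
        = α x ((trivializationAt E (TangentSpace I) x₀).symmL ℝ x w) := by
      rw [he, hG]
      simp only
      rw [trivializationAt_twoTensor x₀ x hx,
        Bundle.Trivialization.symmL_continuousLinearMapAt _ hx, metric_sharp]
    rw [trivializationAt_oneForm]
    exact this.symm
  ext w
  rw [hs, trivializationAt_oneForm, trivializationAt_twoTensor _ _ hx,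
    Bundle.Trivialization.symmL_continuousLinearMapAt _ hx]

/-- The one-form `Θ(α) = Θ(α♯, ·)`, the evaluation of a two-tensor on the metric dual of `α`. -/
def applyForm (h : Metric I M) (Θ : TwoTensor I M) (α : OneForm I M) : OneForm I M where
  toFun x := Θ x (sharp h x (α x))
  contMDiff_toFun := contMDiff_apply_sharp h Θ α

/-! ### The Levi-Civita connection -/

/-- A connection on the tangent bundle is a Levi-Civita connection of `h` if it is torsion-free
and compatible with `h`, that is, `d(h(Y, Z)) = h(∇ Y, Z) + h(Y, ∇ Z)`. -/
structure IsLeviCivita (h : Metric I M)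
    (cov : CovariantDerivative I E (TangentSpace I : M → Type _)) : Prop where
  torsion_eq_zero : cov.torsion = 0
  metric_compatible : ∀ {x : M} {Y Z : ∀ x : M, TangentSpace I x},
    MDiffAt (T% Y) x → MDiffAt (T% Z) x → ∀ v : TangentSpace I x,
      d% (fun y ↦ h.inner y (Y y) (Z y)) x v
        = h.inner x (cov Y x v) (Z x) + h.inner x (Y x) (cov Z x v)

/-- The right-hand side of the Koszul formula for `2 h(∇_X Y, Z)`. -/
def koszul (h : Metric I M) (x : M) (X Y Z : ∀ x : M, TangentSpace I x) : ℝ :=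
  d% (fun y ↦ h.inner y (Y y) (Z y)) x (X x) + d% (fun y ↦ h.inner y (X y) (Z y)) x (Y x)
    - d% (fun y ↦ h.inner y (X y) (Y y)) x (Z x)
    + h.inner x (VectorField.mlieBracket I X Y x) (Z x)
    - h.inner x (VectorField.mlieBracket I X Z x) (Y x)
    - h.inner x (VectorField.mlieBracket I Y Z x) (X x)

section Koszul

variable (h : Metric I M) {x : M} {X X' Y Y' Z Z' : ∀ x : M, TangentSpace I x} {f : M → ℝ}

theorem mvfderiv_metric_smul_left (hf : MDiffAt f x) (hY : MDiffAt (T% Y) x)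
    (hZ : MDiffAt (T% Z) x) (v : TangentSpace I x) :
    d% (fun y ↦ h.inner y ((f • Y) y) (Z y)) x v
      = f x * d% (fun y ↦ h.inner y (Y y) (Z y)) x v + d% f x v * h.inner x (Y x) (Z x) := by
  have : (fun y ↦ h.inner y ((f • Y) y) (Z y)) = fun y ↦ f y * h.inner y (Y y) (Z y) := by
    ext; simp
  rw [this, mvfderiv_fun_mul hf (mdifferentiableAt_metric_apply h hY hZ)]
  simp
  ring

theorem mvfderiv_metric_smul_right (hf : MDiffAt f x) (hY : MDiffAt (T% Y) x)
    (hZ : MDiffAt (T% Z) x) (v : TangentSpace I x) :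
    d% (fun y ↦ h.inner y (Y y) ((f • Z) y)) x v
      = f x * d% (fun y ↦ h.inner y (Y y) (Z y)) x v + d% f x v * h.inner x (Y x) (Z x) := by
  have : (fun y ↦ h.inner y (Y y) ((f • Z) y)) = fun y ↦ f y * h.inner y (Y y) (Z y) := by
    ext; simp
  rw [this, mvfderiv_fun_mul hf (mdifferentiableAt_metric_apply h hY hZ)]
  simp
  ring

theorem mvfderiv_metric_add_left (hY : MDiffAt (T% Y) x) (hY' : MDiffAt (T% Y') x)
    (hZ : MDiffAt (T% Z) x) (v : TangentSpace I x) :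
    d% (fun y ↦ h.inner y ((Y + Y') y) (Z y)) x v
      = d% (fun y ↦ h.inner y (Y y) (Z y)) x v + d% (fun y ↦ h.inner y (Y' y) (Z y)) x v := by
  have : (fun y ↦ h.inner y ((Y + Y') y) (Z y))
      = fun y ↦ h.inner y (Y y) (Z y) + h.inner y (Y' y) (Z y) := by
    ext; simp
  rw [this, mvfderiv_fun_add (mdifferentiableAt_metric_apply h hY hZ)
    (mdifferentiableAt_metric_apply h hY' hZ)]
  simp

theorem mvfderiv_metric_add_right (hY : MDiffAt (T% Y) x) (hZ : MDiffAt (T% Z) x)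
    (hZ' : MDiffAt (T% Z') x) (v : TangentSpace I x) :
    d% (fun y ↦ h.inner y (Y y) ((Z + Z') y)) x v
      = d% (fun y ↦ h.inner y (Y y) (Z y)) x v + d% (fun y ↦ h.inner y (Y y) (Z' y)) x v := by
  have : (fun y ↦ h.inner y (Y y) ((Z + Z') y))
      = fun y ↦ h.inner y (Y y) (Z y) + h.inner y (Y y) (Z' y) := by
    ext; simp
  rw [this, mvfderiv_fun_add (mdifferentiableAt_metric_apply h hY hZ)
    (mdifferentiableAt_metric_apply h hY hZ')]
  simp

theorem koszul_tensorial_left (hY : MDiffAt (T% Y) x) (hZ : MDiffAt (T% Z) x) :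
    TensorialAt I E (koszul h x · Y Z) x where
  smul {f X} hf hX := by
    simp only [koszul]
    rw [mvfderiv_metric_smul_left h hf hX hZ, mvfderiv_metric_smul_left h hf hX hY,
      VectorField.mlieBracket_smul_left hf hX, VectorField.mlieBracket_smul_left hf hX]
    simp
    ring
  add {X X'} hX hX' := by
    simp only [koszul]
    rw [mvfderiv_metric_add_left h hX hX' hZ, mvfderiv_metric_add_left h hX hX' hY,
      VectorField.mlieBracket_add_left hX hX', VectorField.mlieBracket_add_left hX hX']
    simp
    ring

theorem koszul_tensorial_right (hX : MDiffAt (T% X) x) (hY : MDiffAt (T% Y) x) :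
    TensorialAt I E (koszul h x X Y ·) x where
  smul {f Z} hf hZ := by
    simp only [koszul]
    rw [mvfderiv_metric_smul_right h hf hX hZ, mvfderiv_metric_smul_right h hf hY hZ,
      VectorField.mlieBracket_smul_right hf hZ, VectorField.mlieBracket_smul_right hf hZ]
    simp
    rw [h.symm x (Z x) (X x), h.symm x (Z x) (Y x)]
    ring
  add {Z Z'} hZ hZ' := by
    simp only [koszul]
    rw [mvfderiv_metric_add_right h hX hZ hZ', mvfderiv_metric_add_right h hY hZ hZ',
      VectorField.mlieBracket_add_right hZ hZ', VectorField.mlieBracket_add_right hZ hZ']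
    simp
    ring

theorem koszul_smul_middle (hf : MDiffAt f x) (hX : MDiffAt (T% X) x) (hY : MDiffAt (T% Y) x)
    (hZ : MDiffAt (T% Z) x) :
    koszul h x X (f • Y) Z = f x * koszul h x X Y Z
      + 2 * (d% f x (X x) * h.inner x (Y x) (Z x)) := by
  simp only [koszul]
  rw [mvfderiv_metric_smul_left h hf hY hZ, mvfderiv_metric_smul_right h hf hX hY,
    VectorField.mlieBracket_smul_right hf hY, VectorField.mlieBracket_smul_left hf hY]
  simp
  rw [h.symm x (Y x) (X x)]
  ring

theorem koszul_add_middle (hX : MDiffAt (T% X) x) (hY : MDiffAt (T% Y) x)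
    (hY' : MDiffAt (T% Y') x) (hZ : MDiffAt (T% Z) x) :
    koszul h x X (Y + Y') Z = koszul h x X Y Z + koszul h x X Y' Z := by
  simp only [koszul]
  rw [mvfderiv_metric_add_left h hY hY' hZ, mvfderiv_metric_add_right h hX hY hY',
    VectorField.mlieBracket_add_right hY hY', VectorField.mlieBracket_add_left hY hY']
  simp
  ring

open scoped Classical in
/-- The connection defined by the Koszul formula. -/
def koszulConnection (Y : ∀ x : M, TangentSpace I x) (x : M) :
    TangentSpace I x →L[ℝ] TangentSpace I x :=
  if hY : MDiffAt (T% Y) x then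
    haveI : FiniteDimensional ℝ (TangentSpace I x) := inferInstanceAs (FiniteDimensional ℝ E)
    haveI : T2Space (TangentSpace I x) := inferInstanceAs (T2Space E)
    LinearMap.toContinuousLinearMap ((flat h x).symm.toLinearMap ∘ₗ
      ((2⁻¹ : ℝ) • TensorialAt.mkHom₂ (koszul h x · Y ·) x
        (fun _ hZ ↦ koszul_tensorial_left h hY hZ)
        (fun _ hX ↦ koszul_tensorial_right h hX hY) :
          TangentSpace I x →L[ℝ] TangentSpace I x →L[ℝ] ℝ).toLinearMap)
  else 0

theorem metric_koszulConnection (hX : MDiffAt (T% X) x) (hY : MDiffAt (T% Y) x)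
    (hZ : MDiffAt (T% Z) x) :
    2 * h.inner x (koszulConnection h Y x (X x)) (Z x) = koszul h x X Y Z := by
  rw [← TensorialAt.mkHom₂_apply (Φ := (koszul h x · Y ·))
    (fun _ hZ ↦ koszul_tensorial_left h hY hZ) (fun _ hX ↦ koszul_tensorial_right h hX hY) hX hZ,
    ← flat_apply]
  simp [koszulConnection, hY]

theorem exists_mdifferentiableAt_eq (v : TangentSpace I x) :
    ∃ X : ∀ x : M, TangentSpace I x, MDiffAt (T% X) x ∧ X x = v :=
  ⟨FiberBundle.extend E v, FiberBundle.mdifferentiableAt_extend I E v, by simp⟩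

theorem eq_of_metric_eq {v w : TangentSpace I x}
    (H : ∀ z : TangentSpace I x, h.inner x v z = h.inner x w z) : v = w :=
  metric_injective h x (ContinuousLinearMap.ext H)

theorem isCovariantDerivativeOn_koszulConnection :
    IsCovariantDerivativeOn (I := I) (M := M) E (koszulConnection h) Set.univ where
  add {Y Y' x} hY hY' _ := by
    ext v
    refine eq_of_metric_eq h fun z ↦ ?_
    obtain ⟨X, hX, rfl⟩ := exists_mdifferentiableAt_eq v
    obtain ⟨Z, hZ, rfl⟩ := exists_mdifferentiableAt_eq z
    have h1 := metric_koszulConnection h hX (mdifferentiableAt_add_section hY hY') hZ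
    have h2 := metric_koszulConnection h hX hY hZ
    have h3 := metric_koszulConnection h hX hY' hZ
    rw [koszul_add_middle h hX hY hY' hZ] at h1
    simp only [add_apply, map_add]
    linarith
  leibniz {Y f x} hY hf _ := by
    ext v
    refine eq_of_metric_eq h fun z ↦ ?_
    obtain ⟨X, hX, rfl⟩ := exists_mdifferentiableAt_eq v
    obtain ⟨Z, hZ, rfl⟩ := exists_mdifferentiableAt_eq z
    have h1 := metric_koszulConnection h hX (hf.smul_section hY) hZ
    have h2 := metric_koszulConnection h hX hY hZ
    rw [koszul_smul_middle h hf hX hY hZ, ← h2] at h1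
    simp only [add_apply, map_add, smul_apply, map_smul,
      ContinuousLinearMap.smulRight_apply, smul_eq_mul]
    linarith

theorem exists_isLeviCivita :
    ∃ cov : CovariantDerivative I E (TangentSpace I : M → Type _), IsLeviCivita h cov := by
  refine ⟨⟨koszulConnection h, isCovariantDerivativeOn_koszulConnection h⟩, ?_, ?_⟩
  · rw [CovariantDerivative.torsion_eq_zero_iff]
    intro X Y x hX hY
    refine eq_of_metric_eq h fun z ↦ ?_
    obtain ⟨Z, hZ, rfl⟩ := exists_mdifferentiableAt_eq z
    have h1 := metric_koszulConnection h hX hY hZ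
    have h2 := metric_koszulConnection h hY hX hZ
    have e : (fun y ↦ h.inner y (X y) (Y y)) = fun y ↦ h.inner y (Y y) (X y) := by
      ext y; exact h.symm y _ _
    simp only [koszul] at h1 h2
    rw [VectorField.mlieBracket_swap_apply (V := Y) (W := X)] at h2
    rw [e] at h1
    simp only [map_neg, neg_apply, map_sub,
      sub_apply] at h2 ⊢
    linarith
  · intro x Y Z hY hZ v
    obtain ⟨X, hX, rfl⟩ := exists_mdifferentiableAt_eq v
    have h1 := metric_koszulConnection h hX hY hZ
    have h2 := metric_koszulConnection h hX hZ hY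
    have e : (fun y ↦ h.inner y (Z y) (Y y)) = fun y ↦ h.inner y (Y y) (Z y) := by
      ext y; exact h.symm y _ _
    simp only [koszul] at h1 h2
    rw [VectorField.mlieBracket_swap_apply (V := Z) (W := Y), e] at h2
    rw [h.symm x (Y x)]
    simp only [map_neg, neg_apply] at h2 ⊢
    linarith

end Koszul

/-- The Levi-Civita connection `∇^h` of a Riemannian metric. -/
def leviCivita (h : Metric I M) : CovariantDerivative I E (TangentSpace I : M → Type _) :=
  (exists_isLeviCivita h).choose

theorem isLeviCivita_leviCivita (h : Metric I M) : IsLeviCivita h (leviCivita h) :=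
  (exists_isLeviCivita h).choose_spec

/-- The covariant derivative of a one-form, with the direction of differentiation in the first
slot: `(∇α)(X, Y) = (∇_X α)(Y) = X(α(Y)) - α(∇_X Y)`. -/
def covDeriv (cov : CovariantDerivative I E (TangentSpace I : M → Type _)) (α : OneForm I M)
    (x : M) : TangentSpace I x →L[ℝ] TangentSpace I x →L[ℝ] ℝ :=
  TensorialAt.mkHom₂ (fun X Y : ∀ x : M, TangentSpace I x ↦
      d% (fun y ↦ α y (Y y)) x (X x) - α x (cov Y x (X x))) x
    (fun Y _ ↦ covDeriv_tensorial_left cov α x Y) (fun X _ ↦ covDeriv_tensorial_right cov α x X)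

theorem covDeriv_apply (cov : CovariantDerivative I E (TangentSpace I : M → Type _))
    (α : OneForm I M) {x : M} {X Y : ∀ x : M, TangentSpace I x}
    (hX : MDiffAt (T% X) x) (hY : MDiffAt (T% Y) x) :
    covDeriv cov α x (X x) (Y x) = d% (fun y ↦ α y (Y y)) x (X x) - α x (cov Y x (X x)) :=
  TensorialAt.mkHom₂_apply (Φ := fun X Y : ∀ x : M, TangentSpace I x ↦
      d% (fun y ↦ α y (Y y)) x (X x) - α x (cov Y x (X x))) _ _ hX hY

/-- The constraint equations for a Riemannian metric `h`, a two-tensor `Θ` and one-forms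
`eᵤ`, `eₗ`: `∇^h eᵤ + Θ = Θ(eᵤ) ⊗ eᵤ`, `∇^h eₗ = Θ(eₗ) ⊗ eᵤ` and `[Θ(eᵤ)] = 0`. -/
structure ConstraintEquations (h : Metric I M) (Θ : TwoTensor I M) (eᵤ eₗ : OneForm I M) :
    Prop where
  nabla_u : ∀ x, covDeriv (leviCivita h) eᵤ x + Θ x = tensor (applyForm h Θ eᵤ x) (eᵤ x)
  nabla_l : ∀ x, covDeriv (leviCivita h) eₗ x = tensor (applyForm h Θ eₗ x) (eᵤ x)
  zero_class : HasZeroClass (applyForm h Θ eᵤ)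

end General

/-! ### Coframes on three-manifolds -/

section Coframe

variable (S : Type*) [TopologicalSpace S] [ChartedSpace (EuclideanSpace ℝ (Fin 3)) S]
  [IsManifold (𝓡 3) ∞ S]

/-- A global smooth coframe `(eᵤ, eₗ, eₙ)` on a three-manifold. -/
structure Coframe where
  u : OneForm (𝓡 3) S
  l : OneForm (𝓡 3) S
  n : OneForm (𝓡 3) S
  linearIndependent : ∀ x, LinearIndependent ℝ ![u x, l x, n x]

variable {S}

theorem Coframe.eq_zero (e : Coframe S) (x : S) (v : TangentSpace (𝓡 3) x)
    (hu : e.u x v = 0) (hl : e.l x v = 0) (hn : e.n x v = 0) : v = 0 := by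
  have : FiniteDimensional ℝ (TangentSpace (𝓡 3) x) :=
    inferInstanceAs (FiniteDimensional ℝ (EuclideanSpace ℝ (Fin 3)))
  have : T2Space (TangentSpace (𝓡 3) x) :=
    inferInstanceAs (T2Space (EuclideanSpace ℝ (Fin 3)))
  have hdim : Module.finrank ℝ (TangentSpace (𝓡 3) x) = 3 :=
    finrank_euclideanSpace_fin (𝕜 := ℝ) (n := 3)
  have hdim' : Module.finrank ℝ (TangentSpace (𝓡 3) x →L[ℝ] ℝ) = 3 := by
    rw [← (LinearMap.toContinuousLinearMap (𝕜 := ℝ) (E := TangentSpace (𝓡 3) x)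
        (F' := ℝ)).finrank_eq]
    exact Subspace.dual_finrank_eq.trans hdim
  have hspan := (e.linearIndependent x).span_eq_top_of_card_eq_finrank' (by simp [hdim'])
  have key : ∀ φ : TangentSpace (𝓡 3) x →L[ℝ] ℝ, φ v = 0 := by
    intro φ
    have hφ : φ ∈ Submodule.span ℝ (Set.range ![e.u x, e.l x, e.n x]) := by
      rw [hspan]; trivial
    induction hφ using Submodule.span_induction with
    | mem ψ hψ =>
      obtain ⟨i, rfl⟩ := hψ
      fin_cases i <;> simp [hu, hl, hn]
    | zero => simp
    | add a b _ _ ha hb => simp [ha, hb]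
    | smul c a _ ha => simp [ha]
  exact (Module.forall_dual_apply_eq_zero_iff ℝ v).1 fun φ ↦
    key (LinearMap.toContinuousLinearMap φ)

/-- The Riemannian metric `h = eᵤ ⊗ eᵤ + eₗ ⊗ eₗ + eₙ ⊗ eₙ` of a coframe. -/
def Coframe.metric (e : Coframe S) : Metric (𝓡 3) S where
  inner x := tensor (e.u x) (e.u x) + tensor (e.l x) (e.l x) + tensor (e.n x) (e.n x)
  symm x v w := by
    simp [tensor]
    ring
  pos x v hv := by
    have h0 : ¬ (e.u x v = 0 ∧ e.l x v = 0 ∧ e.n x v = 0) :=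
      fun ⟨hu, hl, hn⟩ ↦ hv (e.eq_zero x v hu hl hn)
    simp only [tensor, add_apply, ContinuousLinearMap.smulRight_apply,
      smul_apply, smul_eq_mul]
    by_contra hle
    push Not at hle
    have := mul_self_nonneg (e.u x v)
    have := mul_self_nonneg (e.l x v)
    have := mul_self_nonneg (e.n x v)
    exact h0 ⟨mul_self_eq_zero.1 (by linarith), mul_self_eq_zero.1 (by linarith),
      mul_self_eq_zero.1 (by linarith)⟩
  isVonNBounded x := by
    have : FiniteDimensional ℝ (TangentSpace (𝓡 3) x) :=
      inferInstanceAs (FiniteDimensional ℝ (EuclideanSpace ℝ (Fin 3)))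
    have : T2Space (TangentSpace (𝓡 3) x) :=
      inferInstanceAs (T2Space (EuclideanSpace ℝ (Fin 3)))
    let φ : TangentSpace (𝓡 3) x →ₗ[ℝ] (Fin 3 → ℝ) :=
      LinearMap.pi ![(e.u x).toLinearMap, (e.l x).toLinearMap, (e.n x).toLinearMap]
    have hφ : Function.Injective φ := by
      rw [injective_iff_map_eq_zero]
      intro v hv
      exact e.eq_zero x v (congrFun hv 0) (congrFun hv 1) (congrFun hv 2)
    let ψ : TangentSpace (𝓡 3) x ≃L[ℝ] (Fin 3 → ℝ) :=
      (LinearMap.linearEquivOfInjective φ hφ (by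
        rw [Module.finrank_fin_fun]
        exact finrank_euclideanSpace_fin (𝕜 := ℝ) (n := 3))).toContinuousLinearEquiv
    have hb := (NormedSpace.isVonNBounded_closedBall ℝ (Fin 3 → ℝ) 1).image
      (ψ.symm : (Fin 3 → ℝ) →L[ℝ] TangentSpace (𝓡 3) x)
    refine hb.subset ?_
    intro v hv
    refine ⟨ψ v, ?_, ψ.symm_apply_apply v⟩
    simp only [tensor, add_apply, ContinuousLinearMap.smulRight_apply,
      smul_apply, smul_eq_mul, Set.mem_ofPred_eq] at hv
    have := mul_self_nonneg (e.u x v)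
    have := mul_self_nonneg (e.l x v)
    have := mul_self_nonneg (e.n x v)
    rw [mem_closedBall_zero_iff, pi_norm_le_iff_of_nonneg zero_le_one]
    intro i
    rw [Real.norm_eq_abs]
    refine abs_le_one_iff_mul_self_le_one.2 ?_
    fin_cases i
    · change e.u x v * e.u x v ≤ 1
      linarith
    · change e.l x v * e.l x v ≤ 1
      linarith
    · change e.n x v * e.n x v ≤ 1
      linarith
  contMDiff := ((contMDiff_tensor e.u e.u).add_section (contMDiff_tensor e.l e.l)).add_section
    (contMDiff_tensor e.n e.n)

/-- The exterior differential system for a pair `(e, Θ)`, where `h` is the metric of the coframe: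
`de_a = Θ(e_a) ∧ eᵤ` for `a = u, l, n`, and `[Θ(eᵤ)] = 0`. -/
structure ParallelCauchySystem (e : Coframe S) (Θ : TwoTensor (𝓡 3) S) : Prop where
  d_u : ∀ x, extDeriv e.u x = wedge (applyForm e.metric Θ e.u x) (e.u x)
  d_l : ∀ x, extDeriv e.l x = wedge (applyForm e.metric Θ e.l x) (e.u x)
  d_n : ∀ x, extDeriv e.n x = wedge (applyForm e.metric Θ e.n x) (e.u x)
  zero_class : HasZeroClass (applyForm e.metric Θ e.u)

end Coframe

end CauchyGeometry

end

noncomputable section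

namespace CauchyGeometry

/-! ### Exterior derivative through a torsion-free connection -/

section General

variable {E : Type*} [NormedAddCommGroup E] [NormedSpace ℝ E] {H : Type*} [TopologicalSpace H]
  {I : ModelWithCorners ℝ E H} {M : Type*} [TopologicalSpace M] [ChartedSpace H M]
  [IsManifold I ∞ M]

/-! Write `E_a` for the dual frame and `P_a = Θ(E_a, ·) ⊗ e_u - δ_{au} Θ`, which is
`predictedCovDeriv`. The constraint equations, apart from the cohomological one, say `∇e_u = P_u`
and `∇e_l = P_l`; nothing is imposed on `∇e_n`.

Since `∇` is metric and the coframe is orthonormal, `(∇_v e_a)(E_b)` is skew in `a, b`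
(`covDeriv_skew`). Symmetry of `Θ` gives `P_a(v, E_b)` the same skewness (`predictedCovDeriv_skew`).
Thus the components of `∇e_n` along `E_u` and `E_l` are determined by `∇e_u` and `∇e_l`, and the one
along `E_n` vanishes, so the two equations already force `∇e_n = P_n` (`covDeriv_n_eq_predicted`).

It remains to compare `∇e_a = P_a` with the exterior system for all three indices
(`covDeriv_eq_predicted_iff`). As `∇` is torsion-free, `de_a` is the antisymmetrization of `∇e_a`,
while that of `P_a` is `Θ(e_a) ∧ e_u`. Hence the exterior system says exactly that each `D_a = ∇e_a
- P_a` is symmetric. The `D_a` are also skew in the sense above, and a family with both properties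
is zero (`eq_zero_of_symm_of_skew`); this is the algebra behind uniqueness of the Levi-Civita
connection. The condition `[Θ(e_u)] = 0` is common to both sides. -/

theorem tensor_apply {x : M} (α β : TangentSpace I x →L[ℝ] ℝ) (v w : TangentSpace I x) :
    tensor α β v w = α v * β w := by
  simp [tensor]

theorem wedge_apply {x : M} (α β : TangentSpace I x →L[ℝ] ℝ) (v w : TangentSpace I x) :
    wedge α β v w = α v * β w - β v * α w := by
  simp [wedge, tensor_apply]

variable [FiniteDimensional ℝ E]

theorem applyForm_apply (h : Metric I M) (Θ : TwoTensor I M) (α : OneForm I M) (x : M) :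
    applyForm h Θ α x = Θ x (sharp h x (α x)) := rfl

/-- For a torsion-free connection, the exterior derivative of a one-form is twice the
antisymmetrization of its covariant derivative. -/
theorem extDeriv_eq_covDeriv_sub (cov : CovariantDerivative I E (TangentSpace I : M → Type _))
    (hcov : cov.torsion = 0) (α : OneForm I M) (x : M) (v w : TangentSpace I x) :
    extDeriv α x v w = covDeriv cov α x v w - covDeriv cov α x w v := by
  obtain ⟨X, hX, rfl⟩ := exists_mdifferentiableAt_eq v
  obtain ⟨Y, hY, rfl⟩ := exists_mdifferentiableAt_eq w
  -- Vanishing torsion replaces the bracket `[X, Y]` by `∇_X Y - ∇_Y X`.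
  rw [extDeriv_apply α hX hY, covDeriv_apply cov α hX hY, covDeriv_apply cov α hY hX,
    ← (cov.torsion_eq_zero_iff).1 hcov hX hY, map_sub]
  ring

end General

/-! ### Algebra of symmetric and skew families -/

/-- A family of bilinear forms `D a`, symmetric in the two arguments and skew in the index and the
second argument with respect to a spanning family `E`, vanishes. -/
theorem eq_zero_of_symm_of_skew {ι V : Type*} [AddCommGroup V] [Module ℝ V]
    {E : ι → V} (hE : Submodule.span ℝ (Set.range E) = ⊤) (D : ι → V →ₗ[ℝ] V →ₗ[ℝ] ℝ)
    (hsymm : ∀ a v w, D a v w = D a w v) (hskew : ∀ a b v, D a v (E b) = - D b v (E a))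
    (a : ι) : D a = 0 := by
  refine LinearMap.ext_on_range hE fun b ↦ LinearMap.ext_on_range hE fun c ↦ ?_
  -- Alternating skewness and symmetry three times permutes the indices `a, b, c` back to their
  -- original places and collects three minus signs, so `D a (E b) (E c)` equals its own negative.
  have h1 := hskew a c (E b)
  have h2 := hsymm c (E b) (E a)
  have h3 := hskew c b (E a)
  have h4 := hsymm b (E a) (E c)
  have h5 := hskew b a (E c)
  have h6 := hsymm a (E c) (E b)
  simp only [LinearMap.zero_apply]
  linarith

/-! ### The dual orthonormal frame and its connection forms -/

section Coframe

variable {S : Type*} [TopologicalSpace S] [ChartedSpace (EuclideanSpace ℝ (Fin 3)) S]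
  [IsManifold (𝓡 3) ∞ S] (e : Coframe S)

theorem Coframe.metric_apply (x : S) (v w : TangentSpace (𝓡 3) x) :
    e.metric.inner x v w = e.u x v * e.u x w + e.l x v * e.l x w + e.n x v * e.n x w := by
  simp [Coframe.metric, tensor_apply]

/-- The one-forms of a coframe as a family. -/
def Coframe.form : Fin 3 → OneForm (𝓡 3) S := ![e.u, e.l, e.n]

/-- The frame dual to a coframe. -/
def Coframe.frame (x : S) (a : Fin 3) : TangentSpace (𝓡 3) x :=
  sharp e.metric x (e.form a x)

theorem Coframe.metric_eq_sum (x : S) (v w : TangentSpace (𝓡 3) x) :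
    e.metric.inner x v w = ∑ a, e.form a x v * e.form a x w := by
  simp [e.metric_apply, Fin.sum_univ_three, Coframe.form]

/-- By definition of the musical isomorphism, `h(E_b, ·) = e_b`, that is, `∑ c, e_c(E_b) e_c = e_b`.
Linear independence of the coframe lets the coefficients be compared. -/
theorem Coframe.form_frame (x : S) (a b : Fin 3) :
    e.form a x (e.frame x b) = if a = b then 1 else 0 := by
  have hli := Fintype.linearIndependent_iff.1 (e.linearIndependent x)
    (fun c ↦ e.form c x (e.frame x b) - if c = b then 1 else 0) (by
      ext v
      have h := metric_sharp e.metric x (e.form b x) v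
      change e.metric.inner x (e.frame x b) v = _ at h
      rw [e.metric_eq_sum] at h
      fin_cases b <;>
      · simp [Fin.sum_univ_three, Coframe.form] at h ⊢
        linarith) a
  exact sub_eq_zero.1 hli

/-- Each coframe form takes the same value on both sides, and the coframe separates tangent vectors.
-/
theorem Coframe.sum_frame (x : S) (v : TangentSpace (𝓡 3) x) :
    ∑ a, e.form a x v • e.frame x a = v := by
  have key (b : Fin 3) : e.form b x (∑ a, e.form a x v • e.frame x a - v) = 0 := by
    simp [map_sum, e.form_frame]
  exact sub_eq_zero.1 (e.eq_zero x _ (key 0) (key 1) (key 2))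

theorem Coframe.span_frame (x : S) : Submodule.span ℝ (Set.range (e.frame x)) = ⊤ := by
  refine eq_top_iff.2 fun v _ ↦ ?_
  rw [← e.sum_frame x v]
  exact Submodule.sum_mem _ fun a _ ↦
    Submodule.smul_mem _ _ (Submodule.subset_span (Set.mem_range_self a))

/-- The covariant derivatives of an orthonormal coframe for a metric connection form a skew
matrix of one-forms. -/
theorem Coframe.covDeriv_skew (x : S) (v : TangentSpace (𝓡 3) x) (a b : Fin 3) :
    covDeriv (leviCivita e.metric) (e.form a) x v (e.frame x b)
      = - covDeriv (leviCivita e.metric) (e.form b) x v (e.frame x a) := by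
  set cov := leviCivita e.metric
  -- This is `∇h = 0` written out for `h = ∑ c, e_c ⊗ e_c` with the Leibniz rule.
  have key (y z : TangentSpace (𝓡 3) x) :
      ∑ c, (covDeriv cov (e.form c) x v y * e.form c x z
        + e.form c x y * covDeriv cov (e.form c) x v z) = 0 := by
    obtain ⟨X, hX, rfl⟩ := exists_mdifferentiableAt_eq v
    obtain ⟨Y, hY, rfl⟩ := exists_mdifferentiableAt_eq y
    obtain ⟨Z, hZ, rfl⟩ := exists_mdifferentiableAt_eq z
    have h := (isLeviCivita_leviCivita e.metric).metric_compatible hY hZ (X x)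
    have hd (α : OneForm (𝓡 3) S) :
        MDifferentiableAt (𝓡 3) 𝓘(ℝ, ℝ) (fun y ↦ α y (Y y) * α y (Z y)) x :=
      (mdifferentiableAt_oneForm_apply α hY).mul (mdifferentiableAt_oneForm_apply α hZ)
    have hd' : MDifferentiableAt (𝓡 3) 𝓘(ℝ, ℝ)
        (fun y ↦ e.u y (Y y) * e.u y (Z y) + e.l y (Y y) * e.l y (Z y)) x :=
      (hd e.u).add (hd e.l)
    have hexp : (fun y ↦ e.metric.inner y (Y y) (Z y)) = fun y ↦
        e.u y (Y y) * e.u y (Z y) + e.l y (Y y) * e.l y (Z y)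
          + e.n y (Y y) * e.n y (Z y) := by
      ext y
      exact e.metric_apply y _ _
    rw [hexp, mvfderiv_fun_add hd' (hd e.n),
      mvfderiv_fun_add (hd e.u) (hd e.l),
      mvfderiv_fun_mul (mdifferentiableAt_oneForm_apply e.u hY)
        (mdifferentiableAt_oneForm_apply e.u hZ),
      mvfderiv_fun_mul (mdifferentiableAt_oneForm_apply e.l hY)
        (mdifferentiableAt_oneForm_apply e.l hZ),
      mvfderiv_fun_mul (mdifferentiableAt_oneForm_apply e.n hY)
        (mdifferentiableAt_oneForm_apply e.n hZ),
      e.metric_apply, e.metric_apply] at h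
    simp only [covDeriv_apply cov _ hX hY, covDeriv_apply cov _ hX hZ, Fin.sum_univ_three]
    simp [Coframe.form] at h ⊢
    linarith
  -- On frame vectors duality leaves a single term of each of the two sums.
  have h := key (e.frame x b) (e.frame x a)
  simp only [e.form_frame, Finset.sum_add_distrib, mul_ite, ite_mul, mul_one, one_mul, mul_zero,
    zero_mul, Finset.sum_ite_eq', Finset.mem_univ, if_true] at h
  linarith

/-! ### Comparison with the predicted covariant derivative -/

/-- The covariant derivative `∇ e_a` predicted by the constraint equations, as a bilinear form. -/
def Coframe.predictedCovDeriv (Θ : TwoTensor (𝓡 3) S) (x : S) (a : Fin 3) :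
    TangentSpace (𝓡 3) x →L[ℝ] TangentSpace (𝓡 3) x →L[ℝ] ℝ :=
  tensor (Θ x (e.frame x a)) (e.u x) - (if a = 0 then 1 else 0 : ℝ) • Θ x

variable {Θ : TwoTensor (𝓡 3) S}

theorem Coframe.u_frame (x : S) (b : Fin 3) :
    e.u x (e.frame x b) = if b = 0 then 1 else 0 := by
  simpa [Coframe.form, eq_comm] using e.form_frame x 0 b

theorem Coframe.predictedCovDeriv_apply (x : S) (a : Fin 3) (v w : TangentSpace (𝓡 3) x) :
    e.predictedCovDeriv Θ x a v w
      = Θ x (e.frame x a) v * e.u x w - (if a = 0 then 1 else 0) * Θ x v w := by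
  simp only [Coframe.predictedCovDeriv, sub_apply, smul_apply, tensor_apply, smul_eq_mul]

/-- On the frame, `P_a(v, E_b) = δ_{bu} Θ(E_a, v) - δ_{au} Θ(v, E_b)`; for symmetric `Θ`, exchanging
`a` and `b` exchanges the two terms. -/
theorem Coframe.predictedCovDeriv_skew
    (hΘ : ∀ (x : S) (v w : TangentSpace (𝓡 3) x), Θ x v w = Θ x w v)
    (x : S) (v : TangentSpace (𝓡 3) x) (a b : Fin 3) :
    e.predictedCovDeriv Θ x a v (e.frame x b) = - e.predictedCovDeriv Θ x b v (e.frame x a) := by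
  rw [e.predictedCovDeriv_apply, e.predictedCovDeriv_apply, e.u_frame, e.u_frame,
    hΘ x v (e.frame x b), hΘ x v (e.frame x a)]
  ring

/-- The correction `δ_{au} Θ` is symmetric and cancels, which is why the exterior system has the
same shape for all three indices. -/
theorem Coframe.predictedCovDeriv_sub_swap
    (hΘ : ∀ (x : S) (v w : TangentSpace (𝓡 3) x), Θ x v w = Θ x w v)
    (x : S) (a : Fin 3) (v w : TangentSpace (𝓡 3) x) :
    e.predictedCovDeriv Θ x a v w - e.predictedCovDeriv Θ x a w v
      = wedge (Θ x (e.frame x a)) (e.u x) v w := by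
  rw [e.predictedCovDeriv_apply, e.predictedCovDeriv_apply, wedge_apply, hΘ x v w]
  ring

/-- Antisymmetrizing gives the forward direction. Conversely, the exterior equations only make the
difference of the two tensors symmetric; its skewness on the frame, which holds in any case, then
forces it to vanish. -/
theorem Coframe.covDeriv_eq_predicted_iff
    (hΘ : ∀ (x : S) (v w : TangentSpace (𝓡 3) x), Θ x v w = Θ x w v)
    (x : S) :
    (∀ a, covDeriv (leviCivita e.metric) (e.form a) x = e.predictedCovDeriv Θ x a) ↔
      ∀ a, extDeriv (e.form a) x = wedge (Θ x (e.frame x a)) (e.u x) := by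
  have htor := (isLeviCivita_leviCivita e.metric).torsion_eq_zero
  constructor
  · intro h a
    ext v w
    rw [extDeriv_eq_covDeriv_sub _ htor, h, e.predictedCovDeriv_sub_swap hΘ]
  · intro h a
    let D (a : Fin 3) : TangentSpace (𝓡 3) x →ₗ[ℝ] TangentSpace (𝓡 3) x →ₗ[ℝ] ℝ :=
      LinearMap.mk₂ ℝ (fun v w ↦ covDeriv (leviCivita e.metric) (e.form a) x v w
        - e.predictedCovDeriv Θ x a v w)
        (fun _ _ _ ↦ by simp only [map_add, add_apply]; ring)
        (fun _ _ _ ↦ by simp only [map_smul, smul_apply, smul_eq_mul]; ring)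
        (fun _ _ _ ↦ by simp only [map_add]; ring)
        (fun _ _ _ ↦ by simp only [map_smul, smul_eq_mul]; ring)
    have hD : D a = 0 := by
      refine eq_zero_of_symm_of_skew (e.span_frame x) D (fun a v w ↦ ?_) (fun a b v ↦ ?_) a
      · have h1 := extDeriv_eq_covDeriv_sub _ htor (e.form a) x v w
        have h2 := e.predictedCovDeriv_sub_swap hΘ x a v w
        rw [h a] at h1
        simp only [D, LinearMap.mk₂_apply]
        linarith
      · have h1 := e.covDeriv_skew x v a b
        have h2 := e.predictedCovDeriv_skew hΘ x v a b
        simp only [D, LinearMap.mk₂_apply]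
        linarith
    ext v w
    exact sub_eq_zero.1 (LinearMap.congr_fun₂ hD v w)

/-- The formula for `∇ eₙ` follows from those for `∇ eᵤ` and `∇ eₗ`. -/
theorem Coframe.covDeriv_n_eq_predicted
    (hΘ : ∀ (x : S) (v w : TangentSpace (𝓡 3) x), Θ x v w = Θ x w v)
    (x : S)
    (hu : covDeriv (leviCivita e.metric) (e.form 0) x = e.predictedCovDeriv Θ x 0)
    (hl : covDeriv (leviCivita e.metric) (e.form 1) x = e.predictedCovDeriv Θ x 1) :
    covDeriv (leviCivita e.metric) (e.form 2) x = e.predictedCovDeriv Θ x 2 := by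
  ext v w
  have key (b : Fin 3) : covDeriv (leviCivita e.metric) (e.form 2) x v (e.frame x b)
      = e.predictedCovDeriv Θ x 2 v (e.frame x b) := by
    have h1 := e.covDeriv_skew x v 2 b
    have h2 := e.predictedCovDeriv_skew hΘ x v 2 b
    fin_cases b
    · exact h1.trans ((congrArg (fun T ↦ - T v (e.frame x 2)) hu).trans h2.symm)
    · exact h1.trans ((congrArg (fun T ↦ - T v (e.frame x 2)) hl).trans h2.symm)
    -- With both indices equal to `2`, skewness makes each side its own negative, so both are zero.
    · simp only [Fin.reduceFinMk] at h1 h2 ⊢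
      linarith
  rw [← e.sum_frame x w]
  simp only [map_sum, map_smul, key]

end Coframe

end CauchyGeometry

end

/-- On a smooth three-manifold `S` with a global coframe `e = (eᵤ, eₗ, eₙ)`, its metric
`h = eᵤ ⊗ eᵤ + eₗ ⊗ eₗ + eₙ ⊗ eₙ` and a symmetric two-tensor `Θ`, the constraint equations are
equivalent to the exterior differential system. -/
theorem mainTheorem6 {S : Type*} [TopologicalSpace S]
    [ChartedSpace (EuclideanSpace ℝ (Fin 3)) S] [IsManifold (𝓡 3) ∞ S]
    (e : CauchyGeometry.Coframe S) (Θ : CauchyGeometry.TwoTensor (𝓡 3) S)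
    (hΘ : ∀ (x : S) (v w : TangentSpace (𝓡 3) x), Θ x v w = Θ x w v) :
    CauchyGeometry.ConstraintEquations e.metric Θ e.u e.l ↔
      CauchyGeometry.ParallelCauchySystem e Θ := by
  -- Only the equation for `e_u` carries the extra `Θ`; moving it to the right gives the correction
  -- term of `predictedCovDeriv` at index `0`.
  have hu (x : S) (A : TangentSpace (𝓡 3) x →L[ℝ] TangentSpace (𝓡 3) x →L[ℝ] ℝ) :
      A + Θ x = CauchyGeometry.tensor (CauchyGeometry.applyForm e.metric Θ e.u x) (e.u x) ↔
        A = e.predictedCovDeriv Θ x 0 := by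
    have hp (v w : TangentSpace (𝓡 3) x) : e.predictedCovDeriv Θ x 0 v w
        = CauchyGeometry.tensor (CauchyGeometry.applyForm e.metric Θ e.u x) (e.u x) v w
          - Θ x v w := by
      simp [CauchyGeometry.Coframe.predictedCovDeriv_apply, CauchyGeometry.tensor_apply,
        CauchyGeometry.Coframe.frame, CauchyGeometry.Coframe.form, CauchyGeometry.applyForm_apply]
    constructor <;> intro h <;> ext v w
    · rw [hp, ← h]
      simp
    · rw [h, add_apply, add_apply, hp]
      ring
  have hl (x : S) : e.predictedCovDeriv Θ x 1
      = CauchyGeometry.tensor (CauchyGeometry.applyForm e.metric Θ e.l x) (e.u x) := by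
    ext v w
    simp [CauchyGeometry.Coframe.predictedCovDeriv_apply, CauchyGeometry.tensor_apply,
      CauchyGeometry.Coframe.frame, CauchyGeometry.Coframe.form, CauchyGeometry.applyForm_apply]
  constructor
  · rintro ⟨h1, h2, h3⟩
    have h (x : S) := (e.covDeriv_eq_predicted_iff hΘ x).1 (by
      have hu' := (hu x _).1 (h1 x)
      have hl' := (h2 x).trans (hl x).symm
      intro a
      fin_cases a
      exacts [hu', hl', e.covDeriv_n_eq_predicted hΘ x hu' hl'])
    exact ⟨fun x ↦ h x 0, fun x ↦ h x 1, fun x ↦ h x 2, h3⟩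
  · rintro ⟨h1, h2, h3, h4⟩
    have h (x : S) := (e.covDeriv_eq_predicted_iff hΘ x).2 (by
      intro a
      fin_cases a
      -- `Θ x (e.frame x a)` unfolds to the value at `x` of `applyForm` on the corresponding coframe
      -- form, so the equations apply as they stand.
      exacts [h1 x, h2 x, h3 x])
    exact ⟨fun x ↦ (hu x _).2 (h x 0), fun x ↦ (h x 1).trans (hl x), h4⟩
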